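/- Let $T$ be a complete first-order theory and let $\varphi(x,y)$ be a partitioned formula, where $x$ and $y$ are finite tuples of variables, possibly of different lengths $|x|=m$ and $|y|=n$. Assume that $\varphi(x,y)$ is stable, i.e. no model of $T$ contains tuples $(\bar a_i)_{i<\omega}$, $(\bar b_j)_{j<\omega}$ with $\varphi(\bar a_i,\bar b_j)\iff i<j$ for all $i,j<\omega$. Writing $\varphi$ as $\varphi(x_0,\dots,x_{k-1})$ with $k=m+n$, let $\Delta_\varphi=\{\varphi(x_{\pi(0)},\dots,x_{\pi(k-1)}) : \pi\colon k\to k \text{ any function}\}$. Let $I=(e_q)_{q\in Q}$ be a $\Delta_\varphi$-indiscernible sequence of elements of a model $M$ of $T$, indexed by an infinite linearly ordered set $(Q,<)$; that is, for every $\psi\in\Delta_\varphi$ and all $s_0<\dots<s_{k-1}$ and $t_0<\dots<t_{k-1}$ in $Q$ we have $M\models\psi(e_{s_0},\dots,e_{s_{k-1}})\iff M\models\psi(e_{t_0},\dots,e_{t_{k-1}})$. An increasing tuple of $I$ is a tuple $(e_{q_0},\dots,e_{q_{r-1}})$ with $q_0<\dots<q_{r-1}$ in $Q$. For increasing tuples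 $\bar a=(e_{p_i})_{i<m}$ and $\bar b=(e_{q_j})_{j<n}$ put $f_{\bar a,\bar b}=\{(i,j) : p_i=q_j\}$, and call $\bar a,\bar b$ disjoint if $f_{\bar a,\bar b}=\emptyset$ (if $I$ has no repetitions, $p_i=q_j$ means that the $i$-th entry of $\bar a$ equals the $j$-th entry of $\bar b$). 1. If $\varphi(\bar a,\bar b)$ holds for some disjoint increasing tuples $\bar a$ of length $m$ and $\bar b$ of length $n$ of $I$, then $\varphi(\bar c,\bar d)$ holds for all disjoint increasing tuples $\bar c$ of length $m$ and $\bar d$ of length $n$ of $I$. 2. Moreover, if $\bar a,\bar c$ are increasing tuples of length $m$ and $\bar b,\bar d$ are increasing tuples of length $n$ of $I$, then $$\varphi(\bar a,\bar b)\ \wedge\ f_{\bar a,\bar b}=f_{\bar c,\bar d}\ \implies\ \varphi(\bar c,\bar d).$$ -/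

import Mathlib

open FirstOrder

universe u v w

namespace FirstOrder.Language

variable {L : Language.{u, v}}

/-- The partitioned formula `φ(x; y)`, with `|x| = m` and `|y| = n`, is stable in `T`: it does not
have the order property, i.e. no model of `T` contains tuples `a₀, a₁, …` and `b₀, b₁, …` such that
`φ(aᵢ, bⱼ)` holds exactly when `i < j`. -/
def StableIn (T : L.Theory) {m n : ℕ} (φ : L.Formula (Fin m ⊕ Fin n)) : Prop :=
  ∀ N : Theory.ModelType.{u, v, w} T,
    ¬ ∃ (a : ℕ → Fin m → N) (b : ℕ → Fin n → N),
      ∀ i j : ℕ, φ.Realize (Sum.elim (a i) (b j)) ↔ i < j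

/-- For `φ(x₀, …, x_{k-1})`, the set of all formulas `φ(x_{π(0)}, …, x_{π(k-1)})`, where `π` is an
arbitrary function from `k` to `k`. -/
def substInstances {k : ℕ} (φ : L.Formula (Fin k)) : Set (L.Formula (Fin k)) :=
  {ψ | ∃ π : Fin k → Fin k, ψ = φ.relabel π}

/-- `Δ_φ` for a partitioned formula `φ(x; y)`, read as a formula in the `m + n` variables `xy`. -/
def Delta {m n : ℕ} (φ : L.Formula (Fin m ⊕ Fin n)) : Set (L.Formula (Fin (m + n))) :=
  substInstances (φ.relabel finSumFinEquiv)

/-- The sequence `(I_q)_{q ∈ Q}` is `Δ`-indiscernible: any two increasing tuples from it satisfy the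
same formulas of `Δ`. -/
def IsIndiscernible {M : Type*} [L.Structure M] {Q : Type*} [LinearOrder Q] {k : ℕ}
    (Δ : Set (L.Formula (Fin k))) (I : Q → M) : Prop :=
  ∀ ψ ∈ Δ, ∀ s t : Fin k → Q, StrictMono s → StrictMono t →
    (ψ.Realize (I ∘ s) ↔ ψ.Realize (I ∘ t))

end FirstOrder.Language

/-- The relation `f_{a,b} = {(i, j) : aᵢ = bⱼ}` of two tuples, possibly of different lengths. -/
def coincidence {A : Type*} {m n : ℕ} (a : Fin m → A) (b : Fin n → A) : Set (Fin m × Fin n) :=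
  {p | a p.1 = b p.2}

namespace FirstOrder.Language

variable {L : FirstOrder.Language.{u, v}}

/-- A structure in which `φ` has the order property of every finite length has an ultrapower in
which `φ` has the order property. -/
theorem StableIn.exists_bound {T : L.Theory} {m n : ℕ} {φ : L.Formula (Fin m ⊕ Fin n)}
    (hφ : StableIn.{u, v, w} T φ) (M : Type w) [L.Structure M] [M ⊨ T] [Nonempty M] :
    ∃ N : ℕ, ¬ ∃ (a : ℕ → Fin m → M) (b : ℕ → Fin n → M),
      ∀ i j : ℕ, i < N → j < N → (φ.Realize (Sum.elim (a i) (b j)) ↔ i < j) := by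
  by_contra! H
  choose a b hab using H
  let U : Ultrafilter ℕ := Filter.hyperfilter ℕ
  let P : Type w := (U : Filter ℕ).Product fun _ : ℕ => M
  have hT : P ⊨ T := by
    rw [Theory.model_iff]
    intro σ hσ
    rw [Ultraproduct.sentence_realize]
    exact Filter.Eventually.of_forall fun _ => Theory.realize_sentence_of_mem T hσ
  have : Nonempty P := inferInstanceAs (Nonempty ((U : Filter ℕ).Product fun _ : ℕ => M))
  refine hφ (Theory.ModelType.of T P)
    ⟨fun i x => ((fun N => a N i x : ℕ → M) : (U : Filter ℕ).Product fun _ : ℕ => M),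
      fun j y => ((fun N => b N j y : ℕ → M) : (U : Filter ℕ).Product fun _ : ℕ => M),
      fun i j => ?_⟩
  have key := Ultraproduct.realize_formula_cast (u := U) (M := fun _ : ℕ => M) φ
    (Sum.elim (fun x N => a N i x) (fun y N => b N j y))
  have hcast : (fun z => ((Sum.elim (fun x N => a N i x) (fun y N => b N j y) z : ℕ → M) :
      (U : Filter ℕ).Product fun _ : ℕ => M)) =
      Sum.elim
        (fun x => ((fun N => a N i x : ℕ → M) : (U : Filter ℕ).Product fun _ : ℕ => M))
        (fun y => ((fun N => b N j y : ℕ → M) : (U : Filter ℕ).Product fun _ : ℕ => M)) := by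
    funext z
    cases z <;> rfl
  rw [hcast] at key
  refine key.trans ?_
  have hev : ∀ᶠ N in (U : Filter ℕ), i < N ∧ j < N := by
    have h : ∀ᶠ N in Filter.atTop, i < N ∧ j < N :=
      (Filter.eventually_gt_atTop i).and (Filter.eventually_gt_atTop j)
    rw [← Nat.cofinite_eq_atTop] at h
    exact Filter.hyperfilter_le_cofinite h
  have hiff : ∀ᶠ N in (U : Filter ℕ),
      ((φ.Realize fun z => Sum.elim (fun x N => a N i x) (fun y N => b N j y) z N) ↔ i < j) := by
    filter_upwards [hev] with N hN
    rw [← hab N i j hN.1 hN.2]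
    apply iff_of_eq
    congr 1
    funext z
    cases z <;> rfl
  rw [Filter.eventually_congr hiff]
  exact Filter.eventually_const

/-- Substitution instances of `φ` do not distinguish increasing tuples of an indiscernible
sequence. -/
theorem IsIndiscernible.realize_comp_iff {M : Type*} [L.Structure M] {Q : Type*} [LinearOrder Q]
    {m n : ℕ} {φ : L.Formula (Fin m ⊕ Fin n)} {I : Q → M} (hI : IsIndiscernible (Delta φ) I)
    (π : Fin m ⊕ Fin n → Fin (m + n)) {s t : Fin (m + n) → Q} (hs : StrictMono s)
    (ht : StrictMono t) : φ.Realize (I ∘ s ∘ π) ↔ φ.Realize (I ∘ t ∘ π) := by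
  have h := hI _ ⟨π ∘ finSumFinEquiv.symm, rfl⟩ s t hs ht
  simp only [Formula.realize_relabel] at h
  convert h using 2 <;> funext z <;> simp

end FirstOrder.Language

/-- Two tuples, possibly in different linear orders, have the same order type. -/
def SameOrderType {α A B : Type*} [LinearOrder A] [LinearOrder B] (g : α → A) (h : α → B) : Prop :=
  ∀ x y, g x < g y ↔ h x < h y

namespace SameOrderType

variable {α A B C : Type*} [LinearOrder A] [LinearOrder B] [LinearOrder C]

theorem symm {g : α → A} {h : α → B} (H : SameOrderType g h) : SameOrderType h g :=
  fun x y => (H x y).symm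

theorem trans {g : α → A} {h : α → B} {k : α → C} (H : SameOrderType g h)
    (H' : SameOrderType h k) : SameOrderType g k :=
  fun x y => (H x y).trans (H' x y)

theorem eq_iff {g : α → A} {h : α → B} (H : SameOrderType g h) (x y : α) :
    g x = g y ↔ h x = h y := by
  simp only [le_antisymm_iff, ← not_lt, H x y, H y x]

/-- Every finite tuple has the order type of a tuple of natural numbers. -/
theorem exists_nat [Finite α] (g : α → A) : ∃ h : α → ℕ, SameOrderType g h := by
  classical
  have := Fintype.ofFinite α
  refine ⟨fun x => (Finset.univ.filter fun z => g z < g x).card, fun x y => ⟨fun hxy => ?_, ?_⟩⟩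
  · refine Finset.card_lt_card (Finset.ssubset_iff_of_subset ?_ |>.2 ⟨x, ?_, ?_⟩)
    · intro z hz
      simp only [Finset.mem_filter, Finset.mem_univ, true_and] at hz ⊢
      exact hz.trans hxy
    · simpa using hxy
    · simp
  · contrapose!
    intro hyx
    refine Finset.card_le_card fun z hz => ?_
    simp only [Finset.mem_filter, Finset.mem_univ, true_and] at hz ⊢
    exact hz.trans_le hyx

end SameOrderType

theorem exists_strictMonoOn_Iio (Q : Type*) [LinearOrder Q] [Infinite Q] (N : ℕ) :
    ∃ e : ℕ → Q, StrictMonoOn e (Set.Iio N) := by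
  obtain ⟨S, hS⟩ := Infinite.exists_subset_card_eq Q N
  refine ⟨fun i => if h : i < N then S.orderEmbOfFin hS ⟨i, h⟩ else Classical.arbitrary Q, ?_⟩
  intro i hi j hj hij
  simp only [Set.mem_Iio] at hi hj
  simpa [hi, hj] using hij

theorem sameOrderType_comp_of_strictMonoOn {α Q : Type*} [LinearOrder Q] {e : ℕ → Q} {N : ℕ}
    (he : StrictMonoOn e (Set.Iio N)) {h : α → ℕ} (hN : ∀ x, h x < N) :
    SameOrderType (e ∘ h) h :=
  fun x y => he.lt_iff_lt (hN x) (hN y)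

/-- A strictly increasing partial map on `Fin k` becomes extendable after spreading its values. -/
theorem exists_strictMono_spread {α : Type*} [Finite α] {k B : ℕ} (π : α → Fin k) (h : α → ℕ)
    (H : SameOrderType π h) (hB : ∀ x, h x < B) :
    ∃ s : Fin k → ℕ, StrictMono s ∧ (∀ x, s x < k * (B + 1)) ∧ ∀ z, s (π z) = k * (h z + 1) := by
  classical
  have := Fintype.ofFinite α
  let c : Fin k → Finset ℕ := fun x =>
    insert (x : ℕ) ((Finset.univ.filter fun z => π z ≤ x).image
      fun z => k * (h z + 1) + (x - π z))
  have hc : ∀ x, (c x).Nonempty := fun x => Finset.insert_nonempty _ _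
  have hmem : ∀ x v, v ∈ c x ↔ v = x ∨ ∃ z, π z ≤ x ∧ k * (h z + 1) + (x - π z : ℕ) = v := by
    intro x v
    simp [c]
  refine ⟨fun x => (c x).max' (hc x), fun x y hxy => ?_, fun x => ?_, fun w => ?_⟩
  · have hxy' : (x : ℕ) < y := hxy
    rw [Finset.max'_lt_iff]
    intro v hv
    rcases (hmem x v).1 hv with rfl | ⟨z, hz, rfl⟩
    · exact hxy'.trans_le (Finset.le_max' _ _ ((hmem y _).2 (Or.inl rfl)))
    · have hz' : (π z : ℕ) ≤ x := hz
      refine lt_of_lt_of_le ?_ (Finset.le_max' _ (k * (h z + 1) + (y - π z : ℕ))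
        ((hmem y _).2 (Or.inr ⟨z, hz.trans hxy.le, rfl⟩)))
      omega
  · rw [Finset.max'_lt_iff]
    intro v hv
    have hx := x.2
    rcases (hmem x v).1 hv with rfl | ⟨z, -, rfl⟩
    · exact hx.trans_le (Nat.le_mul_of_pos_right _ (Nat.succ_pos _))
    · have h1 : k * (h z + 1) ≤ k * B := Nat.mul_le_mul_left _ (hB z)
      rw [Nat.mul_succ k B]
      omega
  · refine le_antisymm (Finset.max'_le _ _ _ fun v hv => ?_)
      (Finset.le_max' _ _ ((hmem _ _).2 (Or.inr ⟨w, le_rfl, by simp⟩)))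
    have hw := (π w).2
    rcases (hmem _ v).1 hv with rfl | ⟨z, hz, rfl⟩
    · exact hw.le.trans (Nat.le_mul_of_pos_right _ (Nat.succ_pos _))
    · rcases hz.lt_or_eq with hlt | heq
      · have h1 : k * (h z + 1) ≤ k * h w := Nat.mul_le_mul_left _ ((H z w).1 hlt)
        rw [Nat.mul_succ k (h w)]
        omega
      · rw [(H.eq_iff z w).1 heq, heq]
        simp

/-- A property of tuples that does not distinguish increasing `k`-tuples under any substitution
depends only on the order type. -/
theorem iff_of_sameOrderType {α Q : Type*} [Finite α] [LinearOrder Q] [Infinite Q] {k : ℕ}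
    (hk : Nat.card α ≤ k) {R : (α → Q) → Prop}
    (hR : ∀ (π : α → Fin k) (s t : Fin k → Q), StrictMono s → StrictMono t →
      (R (s ∘ π) ↔ R (t ∘ π)))
    {g g' : α → Q} (H : SameOrderType g g') : R g ↔ R g' := by
  classical
  have := Fintype.ofFinite α
  obtain ⟨h, hh⟩ := SameOrderType.exists_nat g
  obtain ⟨B, hB⟩ := (Set.finite_range h).bddAbove
  have hB' : ∀ x, h x < B + 1 := fun x => Nat.lt_succ_of_le (hB ⟨x, rfl⟩)
  obtain ⟨e, he⟩ := exists_strictMonoOn_Iio Q (k * (B + 1 + 1))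
  have key : ∀ f : α → Q, SameOrderType f h → (R f ↔ R fun z => e (k * (h z + 1))) := by
    intro f hf
    obtain ⟨S, hfS, hS⟩ := Infinite.exists_superset_card_eq (Finset.univ.image f) k
      (Finset.card_image_le.trans (by simpa [Nat.card_eq_fintype_card] using hk))
    have hfr : ∀ z, ∃ i, S.orderEmbOfFin hS i = f z := by
      intro z
      have : f z ∈ Set.range (S.orderEmbOfFin hS) := by
        rw [Finset.range_orderEmbOfFin]
        exact hfS (Finset.mem_image_of_mem _ (Finset.mem_univ z))
      exact this
    choose π hπ using hfr
    have hπh : SameOrderType π h := fun x y => by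
      rw [← hf x y, ← hπ x, ← hπ y, OrderEmbedding.lt_iff_lt]
    obtain ⟨s, hs, hsB, hsπ⟩ := exists_strictMono_spread π h hπh hB'
    have := hR π (S.orderEmbOfFin hS) (e ∘ s) (S.orderEmbOfFin hS).strictMono
      fun x y hxy => he (hsB x) (hsB y) (hs hxy)
    convert this using 2
    · funext z
      exact (hπ z).symm
    · funext z
      simp [hsπ]
  exact (key g hh).trans (key g' (H.symm.trans hh)).symm

/-- If `R` depends only on the order type and has no long half-graphs, then it is invariant under
exchanging a coordinate on the left with a coordinate on the right whose values are adjacent. -/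
theorem iff_comp_swap {m n N : ℕ} {Q : Type*} [LinearOrder Q] [Infinite Q]
    {R : (Fin m ⊕ Fin n → Q) → Prop}
    (hR : ∀ g g', SameOrderType g g' → (R g ↔ R g'))
    (hN : ¬ ∃ (a : ℕ → Fin m → Q) (b : ℕ → Fin n → Q),
      ∀ i j : ℕ, i < N → j < N → (R (Sum.elim (a i) (b j)) ↔ i < j))
    {h : Fin m ⊕ Fin n → ℕ} {i : Fin m} {j : Fin n} (hij : h (.inl i) < h (.inr j))
    (hadj : ∀ z, h (.inl i) ≤ h z → h z ≤ h (.inr j) → z = .inl i ∨ z = .inr j)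
    {g g' : Fin m ⊕ Fin n → Q} (hg : SameOrderType g h)
    (hg' : SameOrderType g' (h ∘ Equiv.swap (.inl i) (.inr j))) : R g ↔ R g' := by
  classical
  obtain ⟨B, hB⟩ := (Set.finite_range h).bddAbove
  have hB' : ∀ x, h x ≤ B := fun x => hB ⟨x, rfl⟩
  obtain ⟨e, he⟩ := exists_strictMonoOn_Iio Q (B + 2 * N + 2)
  let spread : ℕ → Fin m ⊕ Fin n → ℕ := fun t z =>
    if h z < h (.inl i) then h z else if h (.inr j) < h z then h z + (2 * N + 1)
      else h (.inl i) + t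
  let c : ℕ → ℕ → Fin m ⊕ Fin n → ℕ := fun s t =>
    Sum.elim (fun x => spread (2 * s + 1) (.inl x)) (fun y => spread (2 * t) (.inr y))
  have hout : ∀ z, z ≠ .inl i → z ≠ .inr j → h z < h (.inl i) ∨ h (.inr j) < h z := by
    intro z h1 h2
    by_contra! hz
    rcases hadj z hz.1 hz.2 with h | h <;> contradiction
  have hci : ∀ s t, c s t (.inl i) = h (.inl i) + (2 * s + 1) := by
    intro s t
    simp [c, spread, hij.not_gt]
  have hcj : ∀ s t, c s t (.inr j) = h (.inl i) + 2 * t := by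
    intro s t
    simp [c, spread, hij.not_gt]
  have hcz : ∀ s t z, z ≠ .inl i → z ≠ .inr j →
      (h z < h (.inl i) ∧ c s t z = h z) ∨ (h (.inr j) < h z ∧ c s t z = h z + (2 * N + 1)) := by
    intro s t z h1 h2
    rcases hout z h1 h2 with h3 | h3
    · refine Or.inl ⟨h3, ?_⟩
      cases z <;> simp [c, spread, h3]
    · refine Or.inr ⟨h3, ?_⟩
      have h4 := (hij.trans h3).not_gt
      cases z <;> simp [c, spread, h3, h4]
  have hval : ∀ s t z,
      (h z = h (.inl i) ∧ c s t z = h (.inl i) + (2 * s + 1) ∧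
        h (Equiv.swap (.inl i) (.inr j) z) = h (.inr j)) ∨
      (h z = h (.inr j) ∧ c s t z = h (.inl i) + 2 * t ∧
        h (Equiv.swap (.inl i) (.inr j) z) = h (.inl i)) ∨
      (h z < h (.inl i) ∧ c s t z = h z ∧ h (Equiv.swap (.inl i) (.inr j) z) = h z) ∨
      (h (.inr j) < h z ∧ c s t z = h z + (2 * N + 1) ∧
        h (Equiv.swap (.inl i) (.inr j) z) = h z) := by
    intro s t z
    by_cases z1 : z = .inl i
    · rw [z1, Equiv.swap_apply_left]
      exact Or.inl ⟨rfl, hci s t, rfl⟩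
    · by_cases z2 : z = .inr j
      · rw [z2, Equiv.swap_apply_right]
        exact Or.inr (Or.inl ⟨rfl, hcj s t, rfl⟩)
      · rw [Equiv.swap_apply_of_ne_of_ne z1 z2]
        rcases hcz s t z z1 z2 with h1 | h1
        · exact Or.inr (Or.inr (Or.inl ⟨h1.1, h1.2, rfl⟩))
        · exact Or.inr (Or.inr (Or.inr ⟨h1.1, h1.2, rfl⟩))
  have hlt : ∀ s t, s < N → t ≤ N → s < t → SameOrderType (c s t) h := by
    intro s t hs ht hst x y
    have hx := hval s t x
    have hy := hval s t y
    omega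
  have hge : ∀ s t, s < N → t ≤ N → ¬ s < t →
      SameOrderType (c s t) (h ∘ Equiv.swap (.inl i) (.inr j)) := by
    intro s t hs ht hst x y
    have hx := hval s t x
    have hy := hval s t y
    simp only [Function.comp_apply]
    omega
  have hcB : ∀ s t, s < N → t ≤ N → ∀ z, c s t z < B + 2 * N + 2 := by
    intro s t hs ht z
    have h0 := hB' z
    have h1 := hB' (.inl i)
    have hz := hval s t z
    omega
  have htrue : ∀ s t, s < N → t ≤ N → s < t → (R (e ∘ c s t) ↔ R g) := fun s t hs ht hst =>
    hR _ _ (((sameOrderType_comp_of_strictMonoOn he (hcB s t hs ht)).trans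
      (hlt s t hs ht hst)).trans hg.symm)
  have hfalse : ∀ s t, s < N → t ≤ N → ¬ s < t → (R (e ∘ c s t) ↔ R g') :=
    fun s t hs ht hst =>
    hR _ _ (((sameOrderType_comp_of_strictMonoOn he (hcB s t hs ht)).trans
      (hge s t hs ht hst)).trans hg'.symm)
  have hec : ∀ s t, Sum.elim (fun x => e (spread (2 * s + 1) (.inl x)))
      (fun y => e (spread (2 * t) (.inr y))) = e ∘ c s t := by
    intro s t
    funext z
    cases z <;> rfl
  by_contra hne
  by_cases hRg : R g
  · have hRg' : ¬ R g' := fun h => hne (iff_of_true hRg h)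
    refine hN ⟨fun s x => e (spread (2 * s + 1) (.inl x)),
      fun t y => e (spread (2 * t) (.inr y)), fun s t hs ht => ?_⟩
    rw [hec]
    by_cases hst : s < t
    · simp [htrue s t hs ht.le hst, hRg, hst]
    · simp [hfalse s t hs ht.le hst, hRg', hst]
  · have hRg' : R g' := by
      by_contra h
      exact hne (iff_of_false hRg h)
    refine hN ⟨fun s x => e (spread (2 * (N - 1 - s) + 1) (.inl x)),
      fun t y => e (spread (2 * (N - t)) (.inr y)), fun s t hs ht => ?_⟩
    rw [hec]
    by_cases hst : s < t
    · have := hfalse (N - 1 - s) (N - t) (by omega) (by omega) (by omega)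
      simp [this, hRg', hst]
    · have := htrue (N - 1 - s) (N - t) (by omega) (by omega) (by omega)
      simp [this, hRg, hst]

/-- If `R` depends only on the order type and is invariant under exchanging adjacent values of a
left and a right coordinate, then on pairs of increasing tuples it depends only on the
coincidences between them. -/
theorem iff_of_eq_iff_eq {m n : ℕ} {R : (Fin m ⊕ Fin n → ℕ) → Prop}
    (hR : ∀ h h', SameOrderType h h' → (R h ↔ R h'))
    (hswap : ∀ (h : Fin m ⊕ Fin n → ℕ) (i : Fin m) (j : Fin n), h (.inl i) < h (.inr j) →
      (∀ z, h (.inl i) ≤ h z → h z ≤ h (.inr j) → z = .inl i ∨ z = .inr j) →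
      (R h ↔ R (h ∘ Equiv.swap (.inl i) (.inr j))))
    (h h' : Fin m ⊕ Fin n → ℕ) (hl : StrictMono (h ∘ Sum.inl)) (hr : StrictMono (h ∘ Sum.inr))
    (hl' : StrictMono (h' ∘ Sum.inl)) (hr' : StrictMono (h' ∘ Sum.inr))
    (heq : ∀ i j, h (.inl i) = h (.inr j) ↔ h' (.inl i) = h' (.inr j)) : R h ↔ R h' := by
  classical
  let D : (Fin m ⊕ Fin n → ℕ) → (Fin m ⊕ Fin n → ℕ) → Finset (Fin m × Fin n) := fun h h' =>
    Finset.univ.filter fun p => ¬ (h (.inl p.1) < h (.inr p.2) ↔ h' (.inl p.1) < h' (.inr p.2))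
  have hD : ∀ h h' p, p ∈ D h h' ↔
      ¬ (h (.inl p.1) < h (.inr p.2) ↔ h' (.inl p.1) < h' (.inr p.2)) := by
    intro h h' p
    simp [D]
  have hDsymm : ∀ h h', D h h' = D h' h := by
    intro h h'
    ext p
    rw [hD, hD, not_iff_not]
    exact iff_comm
  induction hd : (D h h').card using Nat.strong_induction_on generalizing h h' with
  | _ d ih =>
  by_cases hne : (D h h').Nonempty
  swap
  · refine hR h h' fun x y => ?_
    have hD0 : ∀ i j, h (.inl i) < h (.inr j) ↔ h' (.inl i) < h' (.inr j) := by
      intro i j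
      by_contra hij
      exact hne ⟨(i, j), (hD _ _ _).2 hij⟩
    rcases x with i | i <;> rcases y with j | j
    · exact hl.lt_iff_lt.trans hl'.lt_iff_lt.symm
    · exact hD0 i j
    · have h1 := hD0 j i
      have h2 := heq j i
      omega
    · exact hr.lt_iff_lt.trans hr'.lt_iff_lt.symm
  wlog hlt : ∃ i j, h (.inl i) < h (.inr j) ∧ h' (.inr j) < h' (.inl i) generalizing h h'
  · refine (this h' h hl' hr' hl hr (fun i j => (heq i j).symm) (by rw [hDsymm, hd])
      (by rwa [hDsymm]) ?_).symm
    obtain ⟨⟨i, j⟩, hij⟩ := hne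
    rw [hD] at hij
    have h1 := heq i j
    simp only at hij
    by_cases h2 : h (.inl i) < h (.inr j)
    · exact absurd ⟨i, j, h2, by omega⟩ hlt
    · exact ⟨i, j, by omega, by omega⟩
  obtain ⟨⟨i, j⟩, hij, hmin⟩ := Finset.exists_min_image
    (Finset.univ.filter fun p : Fin m × Fin n =>
      h (.inl p.1) < h (.inr p.2) ∧ h' (.inr p.2) < h' (.inl p.1))
    (fun p => h (.inr p.2) - h (.inl p.1))
    (by obtain ⟨i, j, hij⟩ := hlt; exact ⟨(i, j), by simpa using hij⟩)
  simp only [Finset.mem_filter, Finset.mem_univ, true_and, and_imp, Prod.forall] at hij hmin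
  obtain ⟨hij, hij'⟩ := hij
  have hadj : ∀ z, h (.inl i) ≤ h z → h z ≤ h (.inr j) → z = .inl i ∨ z = .inr j := by
    rintro (x | y) h1 h2
    · left
      by_contra hx
      have hix : i < x := lt_of_le_of_ne (hl.le_iff_le.1 h1) fun h => hx (by rw [h])
      have h3 : h (.inl i) < h (.inl x) := hl hix
      have h4 : h' (.inl i) < h' (.inl x) := hl' hix
      have h5 := heq x j
      have h6 := hmin x j (by omega) (by omega)
      omega
    · right
      by_contra hy
      have hyj : y < j := lt_of_le_of_ne (hr.le_iff_le.1 h2) fun h => hy (by rw [h])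
      have h3 : h (.inr y) < h (.inr j) := hr hyj
      have h4 : h' (.inr y) < h' (.inr j) := hr' hyj
      have h5 := heq i y
      have h6 := hmin i y (by omega) (by omega)
      omega
  have hL : ∀ x, x ≠ i → h (.inl x) < h (.inl i) ∨ h (.inr j) < h (.inl x) := by
    intro x hx
    by_contra! hc
    rcases hadj _ hc.1 hc.2 with h1 | h1
    · exact hx (Sum.inl_injective h1)
    · exact Sum.inl_ne_inr h1
  have hRt : ∀ y, y ≠ j → h (.inr y) < h (.inl i) ∨ h (.inr j) < h (.inr y) := by
    intro y hy
    by_contra! hc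
    rcases hadj _ hc.1 hc.2 with h1 | h1
    · exact Sum.inr_ne_inl h1
    · exact hy (Sum.inr_injective h1)
  rw [hswap h i j hij hadj]
  set k := h ∘ Equiv.swap (.inl i) (.inr j) with hk
  have ki : k (.inl i) = h (.inr j) := by simp [hk]
  have kj : k (.inr j) = h (.inl i) := by simp [hk]
  have kl : ∀ x, x ≠ i → k (.inl x) = h (.inl x) := fun x hx => by
    simp [hk, Equiv.swap_apply_of_ne_of_ne, hx]
  have kr : ∀ y, y ≠ j → k (.inr y) = h (.inr y) := fun y hy => by
    simp [hk, Equiv.swap_apply_of_ne_of_ne, hy]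
  have hkD : ∀ x y, (x, y) ≠ (i, j) →
      ((k (.inl x) < k (.inr y) ↔ h (.inl x) < h (.inr y)) ∧
        (k (.inl x) = k (.inr y) ↔ h (.inl x) = h (.inr y))) := by
    intro x y hxy
    by_cases hx : x = i
    · subst hx
      have hy : y ≠ j := fun h => hxy (by rw [h])
      rw [ki, kr y hy]
      have := hRt y hy
      omega
    · rw [kl x hx]
      have := hL x hx
      by_cases hy : y = j
      · subst hy
        rw [kj]
        omega
      · rw [kr y hy]
        simp
  refine ih _ ?_ k h' ?_ ?_ hl' hr' ?_ rfl
  · rw [← hd]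
    refine Finset.card_lt_card (Finset.ssubset_iff_of_subset ?_ |>.2 ⟨(i, j), ?_, ?_⟩)
    · rintro ⟨x, y⟩ hxy
      rw [hD] at hxy ⊢
      by_cases h1 : (x, y) = (i, j)
      · obtain ⟨rfl, rfl⟩ := Prod.mk.inj h1
        simp only at hxy ⊢
        omega
      · simpa only [(hkD x y h1).1] using hxy
    · rw [hD]
      simp only
      omega
    · rw [hD]
      simp only [ki, kj]
      omega
  · intro x y hxy
    have h1 : h (.inl x) < h (.inl y) := hl hxy
    simp only [Function.comp_apply]
    by_cases hx : x = i
    · subst hx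
      rw [ki, kl y hxy.ne']
      have := hL y hxy.ne'
      omega
    · rw [kl x hx]
      by_cases hy : y = i
      · subst hy
        rw [ki]
        omega
      · rwa [kl y hy]
  · intro x y hxy
    have h1 : h (.inr x) < h (.inr y) := hr hxy
    simp only [Function.comp_apply]
    by_cases hx : x = j
    · subst hx
      rw [kj, kr y hxy.ne']
      omega
    · rw [kr x hx]
      by_cases hy : y = j
      · subst hy
        rw [kj]
        have := hRt x hx
        omega
      · rwa [kr y hy]
  · intro x y
    by_cases h1 : (x, y) = (i, j)
    · obtain ⟨rfl, rfl⟩ := Prod.mk.inj h1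
      rw [ki, kj]
      omega
    · rw [(hkD x y h1).2, heq]

/-- A property of pairs of increasing tuples from an infinite linear order which depends only on
the order type and has no long half-graphs depends only on the coincidences. -/
theorem iff_of_coincidence_eq {m n N : ℕ} {Q : Type*} [LinearOrder Q] [Infinite Q]
    {R : (Fin m ⊕ Fin n → Q) → Prop}
    (hR : ∀ g g', SameOrderType g g' → (R g ↔ R g'))
    (hN : ¬ ∃ (a : ℕ → Fin m → Q) (b : ℕ → Fin n → Q),
      ∀ i j : ℕ, i < N → j < N → (R (Sum.elim (a i) (b j)) ↔ i < j))
    {a c : Fin m → Q} {b d : Fin n → Q} (ha : StrictMono a) (hc : StrictMono c)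
    (hb : StrictMono b) (hd : StrictMono d) (hf : coincidence a b = coincidence c d) :
    R (Sum.elim a b) ↔ R (Sum.elim c d) := by
  have hex : ∀ h : Fin m ⊕ Fin n → ℕ, ∃ g : Fin m ⊕ Fin n → Q, SameOrderType g h := by
    intro h
    obtain ⟨B, hB⟩ := (Set.finite_range h).bddAbove
    obtain ⟨e, he⟩ := exists_strictMonoOn_Iio Q (B + 1)
    exact ⟨e ∘ h, sameOrderType_comp_of_strictMonoOn he
      fun x => Nat.lt_succ_of_le (hB ⟨x, rfl⟩)⟩
  choose G hG using hex
  have hRG : ∀ {g h}, SameOrderType g h → (R (G h) ↔ R g) := fun {g h} H =>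
    hR _ _ ((hG h).trans H.symm)
  obtain ⟨h, hh⟩ := SameOrderType.exists_nat (Sum.elim a b)
  obtain ⟨h', hh'⟩ := SameOrderType.exists_nat (Sum.elim c d)
  rw [← hRG hh, ← hRG hh']
  refine iff_of_eq_iff_eq (R := fun h => R (G h)) (fun h h' H => hRG ((hG h').trans H.symm))
    (fun h i j hij hadj => iff_comp_swap hR hN hij hadj (hG _) (hG _)) h h'
    (fun x y hxy => (hh _ _).1 (ha hxy)) (fun x y hxy => (hh _ _).1 (hb hxy))
    (fun x y hxy => (hh' _ _).1 (hc hxy)) (fun x y hxy => (hh' _ _).1 (hd hxy)) fun i j => ?_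
  rw [← hh.eq_iff, ← hh'.eq_iff]
  exact Set.ext_iff.1 hf (i, j)

/-- An increasing tuple from the sequence `I` is `I ∘ a` for a strictly increasing tuple `a` of
indices. Disjointness and `f_{a,b}` are read on the indices; when `I` has no repetitions
this is the same as reading them on the elements of `I`. -/
theorem propositionP {L : FirstOrder.Language.{u, v}} (T : L.Theory) (hT : T.IsComplete)
    {m n : ℕ} (φ : L.Formula (Fin m ⊕ Fin n))
    (hφ : FirstOrder.Language.StableIn.{u, v, w} T φ)
    {M : Type w} [L.Structure M] [M ⊨ T]
    {Q : Type*} [LinearOrder Q] [Infinite Q] (I : Q → M)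
    (hI : FirstOrder.Language.IsIndiscernible (FirstOrder.Language.Delta φ) I) :
    ((∃ (a : Fin m → Q) (b : Fin n → Q), StrictMono a ∧ StrictMono b ∧
        Disjoint (Set.range a) (Set.range b) ∧ φ.Realize (Sum.elim (I ∘ a) (I ∘ b))) →
      ∀ (c : Fin m → Q) (d : Fin n → Q), StrictMono c → StrictMono d →
        Disjoint (Set.range c) (Set.range d) → φ.Realize (Sum.elim (I ∘ c) (I ∘ d))) ∧
    (∀ (a c : Fin m → Q) (b d : Fin n → Q),
      StrictMono a → StrictMono c → StrictMono b → StrictMono d →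
        φ.Realize (Sum.elim (I ∘ a) (I ∘ b)) → coincidence a b = coincidence c d →
          φ.Realize (Sum.elim (I ∘ c) (I ∘ d))) := by
  have : Nonempty M := Nonempty.map I inferInstance
  obtain ⟨N, hN⟩ := hφ.exists_bound M
  have hcomp : ∀ (a : Fin m → Q) (b : Fin n → Q),
      I ∘ Sum.elim a b = Sum.elim (I ∘ a) (I ∘ b) := fun a b => Sum.comp_elim I a b
  have hmain : ∀ (a c : Fin m → Q) (b d : Fin n → Q),
      StrictMono a → StrictMono c → StrictMono b → StrictMono d →
        φ.Realize (Sum.elim (I ∘ a) (I ∘ b)) → coincidence a b = coincidence c d →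
          φ.Realize (Sum.elim (I ∘ c) (I ∘ d)) := by
    intro a c b d ha hc hb hd hab hf
    rw [← hcomp] at hab ⊢
    refine (iff_of_coincidence_eq (N := N) (R := fun g => φ.Realize (I ∘ g)) ?_ ?_
      ha hc hb hd hf).1 hab
    · exact fun g g' H => iff_of_sameOrderType (k := m + n) (by simp)
        (R := fun g => φ.Realize (I ∘ g)) (fun π s t hs ht => hI.realize_comp_iff π hs ht) H
    · rintro ⟨a, b, hab⟩
      refine hN ⟨fun i => I ∘ a i, fun j => I ∘ b j, fun i j hi hj => ?_⟩
      rw [← hcomp]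
      exact hab i j hi hj
  have hempty : ∀ (a : Fin m → Q) (b : Fin n → Q), Disjoint (Set.range a) (Set.range b) →
      coincidence a b = ∅ := by
    intro a b hab
    refine Set.eq_empty_of_forall_notMem fun p hp => ?_
    exact Set.disjoint_left.1 hab ⟨p.1, rfl⟩ ⟨p.2, hp.symm⟩
  refine ⟨?_, hmain⟩
  rintro ⟨a, b, ha, hb, hdisj, hab⟩ c d hc hd hcd
  exact hmain a c b d ha hc hb hd hab ((hempty a b hdisj).trans (hempty c d hcd).symm)
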